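/- **Setting.** Let $\Phi$ be a finite reduced crystallographic root system in a real vector space, with a fixed base and the corresponding set $\Phi^+$ of positive roots. Let $W$ be its Weyl group, $S$ the set of simple reflections, $\ell$ the length function with respect to $S$, and $T=\{wsw^{-1}: w\in W,\ s\in S\}$ the set of reflections; for $\alpha\in\Phi$ let $s_\alpha\in T$ denote the reflection in $\alpha$, so that each $\tau\in T$ equals $s_\alpha$ for exactly one $\alpha\in\Phi^+$ (the positive root corresponding to $\tau$). Fix a $W$-invariant symmetric bilinear form $(\cdot,\cdot)$ with $(\alpha,\alpha)\ne 0$ for every root $\alpha$ (for instance a $W$-invariant inner product); two roots have the same length if $(\alpha,\alpha)=(\beta,\beta)$. Let $k$ be a field of characteristic $0$, and let $k[W]$ be the $k$-vector space with basis $W$. *Reflection subgroups.* A reflection subgroup $W'\subseteq W$ is a subgroup generated by a subset of $T$. Its canonical generators are the reflections in the simple roots of the root subsystem $\{\alpha\in\Phi: s_\alpha\in W'\}$ with positive roots $\{\alpha\in\Phi^+: s_\alpha\in W'\}$, i.e. in those positive roots of the subsystem that are not a sum of two positive roots of the subsystem. $W'$ is dihedral if it has exactly two canonical generators. *Yang–Baxter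 equations.* A family $\{R_\tau\}_{\tau\in T}$ of elements of a monoid is an (extensible) solution to the Yang–Baxter equations for $W$ if for every dihedral reflection subgroup $W'$ (maximal or not), with canonical generators $a$ and $b$, $$R_a R_{aba} R_{ababa}\cdots R_{bab} R_b = R_b R_{bab}\cdots R_{ababa} R_{aba} R_a ,$$ where each side has $m$ factors, $m$ being the order of $ab$, and the $i$-th factor on the left is $R_{(ab)^{i-1}a}$, $1\le i\le m$. *Mixed Bruhat operators.* Given scalars $p_\tau,q_\tau\in k$ $(\tau\in T)$, the mixed Bruhat operator $M_\tau$ is the $k$-linear operator on $k[W]$ with $$M_\tau(w)=\begin{cases} p_\tau\,\tau w & \text{if } \ell(\tau w)>\ell(w),\\ q_\tau\,\tau w & \text{if } \ell(\tau w)<\ell(w).\end{cases}$$ *Multiplicative functions.* A function $E:\Phi^+\to k$ is multiplicative if $E(\alpha+\beta)=E(\alpha)E(\beta)$ whenever $\alpha$, $\beta$ and $\alpha+\beta$ are positive roots. (The value $0$ is allowed.) **Theorem.** Let $E_1,E_2:\Phi^+\to k$ be multiplicative functions with $E_1(\alpha)\ne E_2(\alpha)$ for every $\alpha\in\Phi^+$.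 For $\tau\in T$ let $\kappa_\tau\in k$ be a scalar whose value depends only on the length of the positive root corresponding to $\tau$. Put $$p_\tau=\frac{\kappa_\tau E_1(\alpha)}{E_1(\alpha)-E_2(\alpha)},\qquad q_\tau=\frac{\kappa_\tau E_2(\alpha)}{E_1(\alpha)-E_2(\alpha)},$$ where $\alpha$ is the positive root corresponding to $\tau$. Then the operators $R_\tau=1+\varepsilon M_\tau$ are an (extensible) solution to the Yang–Baxter equations for $W$, both for a formal variable $\varepsilon$ (as elements of the polynomial ring $\operatorname{End}_k(k[W])[\varepsilon]$) and for every value $\varepsilon\in k$ (as elements of $\operatorname{End}_k(k[W])$). -/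

import Mathlib

noncomputable section

namespace MixedBruhat

/-! ### Weyl groups, lengths and reflections -/

section Weyl

variable {ι V N : Type*} [AddCommGroup V] [Module ℝ V] [AddCommGroup N] [Module ℝ N]
  {P : RootPairing ι ℝ V N}

/-- The reflection `s_α`, as an element of the Weyl group, in the root with index `i`. -/
def refl (P : RootPairing ι ℝ V N) (i : ι) : P.weylGroup :=
  RootPairing.weylGroup.ofIdx P i

/-- The type of positive roots with respect to the base `b`. -/
abbrev PosRoot (b : P.Base) : Type _ := {i : ι // b.IsPos i}

/-- The set `S` of simple reflections. -/
def simpleReflections (b : P.Base) : Set P.weylGroup :=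
  refl P '' (b.support : Set ι)

/-- The length of `w`: the least number of factors in an expansion of `w` as a product of simple
reflections. -/
def length (b : P.Base) (w : P.weylGroup) : ℕ :=
  sInf {n | ∃ l : List P.weylGroup, (∀ s ∈ l, s ∈ simpleReflections b) ∧ l.prod = w ∧
    l.length = n}

/-- The set `T = {w s w⁻¹ : w ∈ W, s ∈ S}` of reflections. -/
def reflections (b : P.Base) : Set P.weylGroup :=
  {t | ∃ w : P.weylGroup, ∃ s ∈ simpleReflections b, t = w * s * w⁻¹}

lemma conj_mem_reflections (b : P.Base) {t : P.weylGroup} (ht : t ∈ reflections b)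
    (w : P.weylGroup) : w * t * w⁻¹ ∈ reflections b := by
  obtain ⟨v, s, hs, rfl⟩ := ht
  exact ⟨w * v, s, hs, by group⟩

lemma refl_mul_self (i : ι) : refl P i * refl P i = 1 := by
  have h : RootPairing.Equiv.reflection P i * RootPairing.Equiv.reflection P i = 1 := by
    nth_rewrite 1 [← RootPairing.Equiv.reflection_inv P i]
    exact inv_mul_cancel _
  exact Subtype.ext h

lemma inv_eq_of_mem_reflections (b : P.Base) {t : P.weylGroup} (ht : t ∈ reflections b) :
    t⁻¹ = t := by
  obtain ⟨v, s, ⟨i, _, rfl⟩, rfl⟩ := ht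
  have h : (refl P i)⁻¹ = refl P i := inv_eq_of_mul_eq_one_left (refl_mul_self i)
  simp [mul_assoc, h]

/-- For reflections `a`, `b`, the alternating word `(ab)ⁿa = aba⋯ba` is a reflection. -/
lemma alternating_mem_reflections (b : P.Base) {s t : P.weylGroup} (hs : s ∈ reflections b)
    (ht : t ∈ reflections b) (n : ℕ) : (s * t) ^ n * s ∈ reflections b := by
  induction n using Nat.twoStepInduction with
  | zero => simpa using hs
  | one =>
    have h := conj_mem_reflections b ht s
    rw [inv_eq_of_mem_reflections b hs] at h
    simpa using h
  | more n ih _ =>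
    have h := conj_mem_reflections b ih (s * t)
    have e : s * t * ((s * t) ^ n * s) * (s * t)⁻¹ = (s * t) ^ (n + 2) * s := by
      rw [mul_inv_rev, inv_eq_of_mem_reflections b hs, inv_eq_of_mem_reflections b ht,
        pow_succ (s * t) (n + 1), pow_succ' (s * t) n]
      simp only [mul_assoc]
    rwa [e] at h

/-- The reflection `(st)ⁿs` as an element of `T`; for `n = 0, 1, 2, …` these are
`s, sts, ststs, …`. -/
def alternating (b : P.Base) (s t : reflections b) (n : ℕ) : reflections b :=
  ⟨((s : P.weylGroup) * t) ^ n * s, alternating_mem_reflections b s.2 t.2 n⟩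

/-! ### Reflection subgroups and their canonical generators -/

/-- A reflection subgroup is a subgroup generated by a set of reflections. -/
def IsReflectionSubgroup (b : P.Base) (W' : Subgroup P.weylGroup) : Prop :=
  ∃ A : Set P.weylGroup, A ⊆ reflections b ∧ W' = Subgroup.closure A

/-- The positive roots of the root subsystem `{α : s_α ∈ W'}` attached to `W'`. -/
def subsystemPos (b : P.Base) (W' : Subgroup P.weylGroup) : Set ι :=
  {i | b.IsPos i ∧ refl P i ∈ W'}

/-- The simple roots of the subsystem attached to `W'`: those of its positive roots that are not
the sum of two of its positive roots. -/
def subsystemSimple (b : P.Base) (W' : Subgroup P.weylGroup) : Set ι :=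
  {i | i ∈ subsystemPos b W' ∧
    ¬ ∃ j ∈ subsystemPos b W', ∃ k ∈ subsystemPos b W', P.root i = P.root j + P.root k}

/-- The canonical generators `S'` of `W'`: the reflections in the simple roots of the subsystem. -/
def canonicalGenerators (b : P.Base) (W' : Subgroup P.weylGroup) : Set P.weylGroup :=
  refl P '' subsystemSimple b W'

/-- `W'` is a dihedral reflection subgroup with the two canonical generators `s ≠ t`. -/
def IsDihedralWith (b : P.Base) (W' : Subgroup P.weylGroup) (s t : P.weylGroup) : Prop :=
  IsReflectionSubgroup b W' ∧ s ≠ t ∧ canonicalGenerators b W' = {s, t}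

/-! ### The Yang-Baxter equations -/

/-- The product `R_s R_{sts} R_{ststs} ⋯ R_{tst} R_t`, with one factor for each of the `m`
reflections of the dihedral group generated by `s` and `t`, where `m` is the order of `st`
(the last factor is `R_t`, since `(st)^(m-1) s = t`). -/
def ybProduct {G : Type*} [Monoid G] (b : P.Base) (R : reflections b → G)
    (s t : reflections b) : G :=
  ((List.range (orderOf ((s : P.weylGroup) * t))).map fun n => R (alternating b s t n)).prod

/-- A family of elements of a monoid, indexed by the reflections, is an (extensible) solution to
the Yang-Baxter equations: `R_s R_{sts} ⋯ R_{tst} R_t = R_t R_{tst} ⋯ R_{sts} R_s` for *every*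
dihedral reflection subgroup (maximal or not), `s` and `t` being its canonical generators. -/
def IsYangBaxterSolution {G : Type*} [Monoid G] (b : P.Base) (R : reflections b → G) : Prop :=
  ∀ (W' : Subgroup P.weylGroup) (s t : reflections b), IsDihedralWith b W' s t →
    ybProduct b R s t = ybProduct b R t s

/-! ### Mixed Bruhat operators -/

variable {k : Type*} [Field k]

/-- The mixed Bruhat operator `M_τ` on the span `k[W]`: `w ↦ p_τ τw` if `ℓ(τw) > ℓ(w)` and
`w ↦ q_τ τw` if `ℓ(τw) < ℓ(w)` (the lengths of `w` and `τw` always differ). -/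
def mixedBruhat (b : P.Base) (p q : reflections b → k) (τ : reflections b) :
    Module.End k (P.weylGroup →₀ k) :=
  Finsupp.linearCombination k fun w : P.weylGroup =>
    Finsupp.single ((τ : P.weylGroup) * w)
      (if length b w < length b ((τ : P.weylGroup) * w) then p τ else q τ)

/-- A function `E` on the positive roots is multiplicative if `E (α + β) = E α * E β` whenever
`α`, `β` and `α + β` are positive roots. -/
def IsMultiplicative (b : P.Base) (E : PosRoot b → k) : Prop :=
  ∀ α β γ : PosRoot b, P.root γ = P.root α + P.root β → E γ = E α * E β

end Weyl

end MixedBruhat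

end

noncomputable section

namespace MixedBruhat

/-! ### Weyl group action, exchange property and length. -/

section Exchange

variable {ι V N : Type*} [AddCommGroup V] [Module ℝ V] [AddCommGroup N] [Module ℝ N]
  {P : RootPairing ι ℝ V N}

/-! Set F = E₂/(E₁ - E₂), so that q = κF and p - q = κ. The operators factor through Hecke
operators. For a positive root gα with reflection τ, `one_add_smul_mixedBruhat` writes 1 + εM_τ as
L_g (T_α + εκF(gα)) L_{g s_α}⁻¹. Here L is left multiplication, and T_α sends w to s_α w, with an
extra multiple of w when w⁻¹ makes α negative. Along the reflections a, aba, ababa, … the elements g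
are the prefixes of the word aba⋯, so the outer factors telescope (`ybProduct_eq`). Since aba⋯ =
bab⋯, the last translation is common to both sides of the Yang–Baxter equation. What remains is an
identity between products of factors T + cF·1, with T alternating between T_a and T_b.

That identity needs two inputs. First, T_a and T_b satisfy quadratic relations (`heckeOp_mul_self`)
and the braid relation (`heckeOp_braid`), even though a and b need not be simple in W. Second,
multiplicativity of E₁ and E₂ gives F(α+β)(1 + F(α) + F(β)) = F(α)F(β) (`functional_equation`). The
rest is rank two: two simple roots of a subsystem have the pairings of A₁×A₁, A₂, B₂ or G₂
(`pairing_mem_of_subsystemSimple`), and each type is settled by expanding (`baxter_two`,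
`baxter_three`, `baxter_four`, `baxter_six`). The formal variable follows from all scalar values
because k is infinite. -/

lemma root_smul (w : P.weylGroup) (i : ι) : P.root (w • i) = w • P.root i :=
  (P.weylGroup_apply_root w i).symm

lemma refl_smul (i : ι) (v : V) : refl P i • v = v - P.coroot' i v • P.root i := by
  change P.reflection i v = _
  rw [P.reflection_apply]

lemma refl_smul_root (i j : ι) : refl P i • P.root j = P.root j - P.pairing j i • P.root i := by
  rw [refl_smul, P.root_coroot'_eq_pairing]

lemma refl_smul_root_self (i : ι) : refl P i • P.root i = -P.root i := by
  rw [refl_smul_root, P.pairing_same, two_smul]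
  abel

lemma refl_inv (i : ι) : (refl P i)⁻¹ = refl P i :=
  inv_eq_of_mul_eq_one_left (refl_mul_self i)

lemma refl_mul_cancel_left (i : ι) (w : P.weylGroup) : refl P i * (refl P i * w) = w := by
  rw [← mul_assoc, refl_mul_self, one_mul]

/-- An element of the Weyl group is determined by its action on the root space. -/
lemma ext_smul {v w : P.weylGroup} (h : ∀ x : V, v • x = w • x) : v = w := by
  apply Subtype.ext
  apply RootPairing.Equiv.weightHom_injective P
  ext x
  exact h x

lemma weylGroup_smul_smul (w : P.weylGroup) (c : ℝ) (x : V) : w • (c • x) = c • (w • x) :=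
  (RootPairing.Equiv.weightHom P (w : P.Aut)).map_smul c x

lemma coroot'_smul_smul (w : P.weylGroup) (i : ι) (x : V) :
    P.coroot' (w • i) (w • x) = P.coroot' i x := by
  have h := LinearMap.congr_fun (RootPairing.Hom.weight_coweight_transpose_apply P P
    (P.coroot (w • i)) (w : P.Aut).toHom) x
  rw [RootPairing.Hom.coroot_coweightMap_apply] at h
  have h' : (w : P.Aut).toHom.indexEquiv.symm (w • i) = i :=
    (w : P.Aut).toHom.indexEquiv.symm_apply_apply i
  rw [h'] at h
  exact h

lemma refl_smul_index (w : P.weylGroup) (i : ι) : refl P (w • i) = w * refl P i * w⁻¹ := by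
  apply ext_smul
  intro x
  obtain ⟨y, rfl⟩ : ∃ y, x = w • y := ⟨w⁻¹ • x, by simp⟩
  rw [refl_smul, root_smul, coroot'_smul_smul]
  simp only [mul_smul, inv_smul_smul, refl_smul, smul_sub, weylGroup_smul_smul]

/-- The linear form on the root space which takes the value `1` on the simple roots: on roots it is
the height. -/
lemma exists_height_form [P.IsRootSystem] (b : P.Base) :
    ∃ f : V →ₗ[ℝ] ℝ, ∀ i, f (P.root i) = b.height i := by
  refine ⟨b.toWeightBasis.constr ℝ fun _ => (1 : ℝ), fun i => ?_⟩
  have h1 : ∀ j ∈ b.support, b.toWeightBasis.constr ℝ (fun _ => (1 : ℝ)) (P.root j) = 1 := by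
    intro j hj
    have := b.toWeightBasis.constr_basis ℝ (fun _ => (1 : ℝ)) ⟨j, hj⟩
    simpa using this
  obtain ⟨f, -, -, hf⟩ := b.exists_root_eq_sum_int i
  rw [RootPairing.Base.height_eq_sum hf, hf, map_sum, Int.cast_sum]
  refine Finset.sum_congr rfl fun j hj => ?_
  rw [map_zsmul, h1 j hj]
  simp

/-- The inverse of s_α w carries α to -w⁻¹α. This exchanges the two branches in the length criterion
and in the Hecke operators. -/
lemma isPos_refl_smul_self_iff (b : P.Base) (w : P.weylGroup) (i : ι) :
    b.IsPos ((refl P i * w)⁻¹ • i) ↔ ¬ b.IsPos (w⁻¹ • i) := by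
  let := P.indexNeg
  rw [← RootPairing.Base.IsPos.neg_iff_not]
  have : (refl P i * w)⁻¹ • i = -(w⁻¹ • i) := by
    apply P.root.injective
    rw [mul_inv_rev, refl_inv, mul_smul, root_smul, root_smul, refl_smul_root_self]
    rw [P.indexNeg_neg, P.root_reflectionPerm, P.reflection_apply_self, root_smul]
    simp
  rw [this]

variable [Finite ι] [P.IsCrystallographic] [P.IsReduced] (b : P.Base)

lemma refl_mem_closure_simpleReflections (i : ι) :
    refl P i ∈ Subgroup.closure (simpleReflections b) := by
  have hs : ∀ j ∈ b.support, refl P j ∈ Subgroup.closure (simpleReflections b) := fun j hj =>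
    Subgroup.subset_closure ⟨j, hj, rfl⟩
  have hc (i j : ι) : refl P (P.reflectionPerm j i) = refl P j * refl P i * (refl P j)⁻¹ :=
    refl_smul_index (refl P j) i
  refine b.induction_reflect i (p := fun i => refl P i ∈ Subgroup.closure (simpleReflections b))
    (fun i hi => ?_) hs (fun i j hi hj => ?_)
  · rw [hc]
    exact mul_mem (mul_mem hi hi) (inv_mem hi)
  · rw [hc]
    exact mul_mem (mul_mem (hs j hj) hi) (inv_mem (hs j hj))

lemma closure_simpleReflections : Subgroup.closure (simpleReflections b) = ⊤ := by
  rw [eq_top_iff]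
  rintro ⟨w, hw⟩ -
  induction hw using RootPairing.weylGroup.induction with
  | mem i => exact refl_mem_closure_simpleReflections b i
  | one => exact one_mem _
  | mul x y hx hy hx' hy' => exact mul_mem hx' hy'

lemma exists_list_prod_eq (w : P.weylGroup) :
    ∃ l : List P.weylGroup, (∀ s ∈ l, s ∈ simpleReflections b) ∧ l.prod = w := by
  have hw : w ∈ (Subgroup.closure (simpleReflections b)).toSubmonoid := by
    rw [closure_simpleReflections b]; trivial
  rw [Subgroup.closure_toSubmonoid] at hw
  obtain ⟨l, hl, rfl⟩ := Submonoid.exists_list_of_mem_closure hw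
  refine ⟨l, fun s hs => ?_, rfl⟩
  rcases hl s hs with h | ⟨i, hi, h⟩
  · exact h
  · exact ⟨i, hi, by rw [← inv_inv s, ← h, refl_inv]⟩

lemma exists_reduced_word (w : P.weylGroup) :
    ∃ l : List P.weylGroup, (∀ s ∈ l, s ∈ simpleReflections b) ∧ l.prod = w ∧
      l.length = length b w := by
  obtain ⟨l, hl, hw⟩ := exists_list_prod_eq b w
  exact Nat.sInf_mem (s := {n | ∃ l : List P.weylGroup, (∀ s ∈ l, s ∈ simpleReflections b) ∧
    l.prod = w ∧ l.length = n}) ⟨_, l, hl, hw, rfl⟩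

omit [Finite ι] [P.IsCrystallographic] [P.IsReduced] in
lemma length_le_of_prod_eq {w : P.weylGroup} {l : List P.weylGroup}
    (hl : ∀ s ∈ l, s ∈ simpleReflections b) (hw : l.prod = w) : length b w ≤ l.length :=
  Nat.sInf_le ⟨l, hl, hw, rfl⟩

/-- The strong exchange property. -/
lemma exists_shorter_word (l : List P.weylGroup) (hl : ∀ s ∈ l, s ∈ simpleReflections b) (i : ι)
    (hi : b.IsPos i) (hi' : ¬ b.IsPos (l.prod⁻¹ • i)) :
    ∃ l' : List P.weylGroup, (∀ s ∈ l', s ∈ simpleReflections b) ∧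
      l'.prod = refl P i * l.prod ∧ l'.length < l.length := by
  induction l generalizing i with
  | nil => simp [hi] at hi'
  | cons s l ih =>
    obtain ⟨j, hj, rfl⟩ := hl s (by simp)
    have hl' : ∀ s ∈ l, s ∈ simpleReflections b := fun s hs => hl s (by simp [hs])
    rw [List.prod_cons] at hi' ⊢
    -- If α is the simple root of the first letter, that letter is deleted. Otherwise the first
    -- letter keeps α positive, and the deletion happens further along the word.
    rcases eq_or_ne i j with rfl | hij
    · exact ⟨l, hl', (refl_mul_cancel_left _ _).symm, by simp⟩
    · have hpos : b.IsPos (refl P j • i) := hi.reflectionPerm hj hij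
      rw [mul_inv_rev, refl_inv, mul_smul] at hi'
      obtain ⟨l', h1, h2, h3⟩ := ih hl' _ hpos hi'
      refine ⟨refl P j :: l', ?_, ?_, by simpa using h3⟩
      · rintro s (_ | ⟨_, hs⟩)
        exacts [⟨j, hj, rfl⟩, h1 s hs]
      · rw [List.prod_cons, h2, refl_smul_index, refl_inv]
        simp only [mul_assoc, refl_mul_cancel_left]

lemma length_refl_mul_lt {w : P.weylGroup} {i : ι} (hi : b.IsPos i) (hw : ¬ b.IsPos (w⁻¹ • i)) :
    length b (refl P i * w) < length b w := by
  obtain ⟨l, hl, rfl, hlen⟩ := exists_reduced_word b w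
  obtain ⟨l', h1, h2, h3⟩ := exists_shorter_word b l hl i hi hw
  rw [← hlen]
  exact (length_le_of_prod_eq b h1 h2).trans_lt h3

/-- Left multiplication by the reflection in a positive root increases the length of `w` if and
only if `w⁻¹` keeps the root positive. -/
lemma length_lt_length_refl_mul_iff (w : P.weylGroup) {i : ι} (hi : b.IsPos i) :
    length b w < length b (refl P i * w) ↔ b.IsPos (w⁻¹ • i) := by
  refine ⟨fun h => ?_, fun h => ?_⟩
  · by_contra hn
    exact (h.trans (length_refl_mul_lt b hi hn)).false
  · have h' := length_refl_mul_lt b hi (w := refl P i * w)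
      (by rw [isPos_refl_smul_self_iff]; exact not_not.mpr h)
    rwa [refl_mul_cancel_left] at h'

end Exchange

/-! ### Rank-two identities in algebras with quadratic and braid relations. -/

section BaxterRelations

variable {k A : Type*} [CommRing k] [Ring A] [Algebra k A]

lemma mul_mul_of_mul_self {a : A} {c : k} (ha : a * a = 1 + c • a) (x : A) :
    a * (a * x) = x + c • (a * x) := by
  rw [← mul_assoc, ha, add_mul, one_mul, smul_mul_assoc]

lemma baxter_two {a b : A} (h : a * b = b * a) (u v : k) :
    (a + u • 1) * (b + v • 1) = (b + v • 1) * (a + u • 1) := by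
  simp only [add_mul, mul_add, smul_mul_assoc, mul_smul_comm, one_mul, mul_one, h]
  match_scalars <;> ring

/-- The relations bring both expansions to a common normal form, after which coefficients are
compared. In this and the next identities, the hypothesis `h₁₃` expresses that the second root is
the sum of the first and third, and similarly for the other index pairs. -/
lemma baxter_three {a b : A} {c : k} (ha : a * a = 1 + c • a) (hb : b * b = 1 + c • b)
    (h : a * (b * a) = b * (a * b)) {f₁ f₂ f₃ : k} (h₁₃ : f₂ * (1 + f₁ + f₃) = f₁ * f₃) :
    (a + (c * f₁) • 1) * ((b + (c * f₂) • 1) * (a + (c * f₃) • 1)) =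
      (b + (c * f₃) • 1) * ((a + (c * f₂) • 1) * (b + (c * f₁) • 1)) := by
  simp only [add_mul, mul_add, smul_mul_assoc, mul_smul_comm, one_mul, mul_one, ha, hb, h]
  match_scalars <;> first
    | ring1
    | linear_combination c ^ 2 * h₁₃
    | linear_combination -c ^ 2 * h₁₃

lemma baxter_four {a b : A} {c d : k} (ha : a * a = 1 + c • a) (hb : b * b = 1 + d • b)
    (h : a * (b * (a * b)) = b * (a * (b * a))) {f₁ f₂ f₃ f₄ : k}
    (h₁₃ : f₂ * (1 + f₁ + f₃) = f₁ * f₃) (h₁₄ : f₃ * (1 + f₁ + f₄) = f₁ * f₄) :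
    (a + (c * f₁) • 1) * ((b + (d * f₂) • 1) * ((a + (c * f₃) • 1) * (b + (d * f₄) • 1))) =
      (b + (d * f₄) • 1) * ((a + (c * f₃) • 1) * ((b + (d * f₂) • 1) * (a + (c * f₁) • 1))) := by
  have ha' := mul_mul_of_mul_self ha
  have hb' := mul_mul_of_mul_self hb
  simp only [add_mul, mul_add, smul_mul_assoc, mul_smul_comm, one_mul, mul_one, smul_add, smul_smul,
    ha, hb, ha', hb', h]
  match_scalars <;> first
    | ring1
    | linear_combination c * d * (h₁₃ + h₁₄)
    | linear_combination -c * d * (h₁₃ + h₁₄)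

/-- The c²d² part of a coefficient in the G₂ expansion. Unlike the other parts, it is not handled
there by adding up the relations with constant weights. -/
lemma baxter_six_scalar {f₁ f₂ f₃ f₄ f₅ f₆ : k}
    (h₁₅ : f₃ * (1 + f₁ + f₅) = f₁ * f₅) (h₁₃ : f₂ * (1 + f₁ + f₃) = f₁ * f₃)
    (h₃₅ : f₄ * (1 + f₃ + f₅) = f₃ * f₅) (h₁₆ : f₅ * (1 + f₁ + f₆) = f₁ * f₆)
    (h₂₆ : f₄ * (1 + f₂ + f₆) = f₂ * f₆) :
    f₂ * f₄ + f₂ * f₅ + f₁ * f₂ * f₄ + f₂ * f₃ * f₄ + f₂ * f₄ * f₅ + f₂ * f₅ * f₆ + f₃ * f₅ +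
      f₁ * f₂ * f₅ + f₂ * f₃ * f₅ + f₃ * f₄ * f₅ + f₃ * f₅ * f₆ + f₁ * f₂ * f₃ * f₄ +
      f₁ * f₂ * f₄ * f₅ + f₁ * f₂ * f₅ * f₆ + f₂ * f₃ * f₄ * f₅ + f₂ * f₃ * f₅ * f₆ +
      f₃ * f₄ * f₅ * f₆ =
    f₁ * f₄ * f₆ + f₁ * f₃ * f₆ + f₁ * f₂ * f₃ * f₆ + f₁ * f₃ * f₄ * f₆ + f₁ * f₄ * f₅ * f₆ := by
  grind

lemma baxter_six {a b : A} {c d : k} (ha : a * a = 1 + c • a) (hb : b * b = 1 + d • b)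
    (h : a * (b * (a * (b * (a * b)))) = b * (a * (b * (a * (b * a)))))
    {f₁ f₂ f₃ f₄ f₅ f₆ : k}
    (h₁₅ : f₃ * (1 + f₁ + f₅) = f₁ * f₅) (h₁₃ : f₂ * (1 + f₁ + f₃) = f₁ * f₃)
    (h₃₅ : f₄ * (1 + f₃ + f₅) = f₃ * f₅) (h₁₆ : f₅ * (1 + f₁ + f₆) = f₁ * f₆)
    (h₂₆ : f₄ * (1 + f₂ + f₆) = f₂ * f₆) :
    (a + (c * f₁) • 1) * ((b + (d * f₂) • 1) * ((a + (c * f₃) • 1) * ((b + (d * f₄) • 1) *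
      ((a + (c * f₅) • 1) * (b + (d * f₆) • 1))))) =
    (b + (d * f₆) • 1) * ((a + (c * f₅) • 1) * ((b + (d * f₄) • 1) * ((a + (c * f₃) • 1) *
      ((b + (d * f₂) • 1) * (a + (c * f₁) • 1))))) := by
  have ha' := mul_mul_of_mul_self ha
  have hb' := mul_mul_of_mul_self hb
  have hs := baxter_six_scalar h₁₅ h₁₃ h₃₅ h₁₆ h₂₆
  simp only [add_mul, mul_add, smul_mul_assoc, mul_smul_comm, one_mul, mul_one, smul_add, smul_smul,
    ha, hb, ha', hb', h]
  match_scalars <;> first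
    | ring1
    | linear_combination c * d * (h₁₃ + h₃₅ + h₁₅ + h₁₆)
    | linear_combination -c * d * (h₁₃ + h₃₅ + h₁₅ + h₁₆)
    | linear_combination c ^ 2 * h₁₅ + d ^ 2 * h₂₆ + c ^ 2 * d ^ 2 * hs
    | linear_combination -c ^ 2 * h₁₅ - d ^ 2 * h₂₆ - c ^ 2 * d ^ 2 * hs

end BaxterRelations

/-! ### Alternating words and telescoping products. -/

section Alternating

variable {G : Type*} [Monoid G]

/-- The alternating sequence `x, y, x, y, …`. -/
def letter {X : Type*} (x y : X) (n : ℕ) : X := if Even n then x else y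

lemma letter_succ {X : Type*} (x y : X) (n : ℕ) : letter x y (n + 1) = letter y x n := by
  by_cases h : Even n <;> simp [letter, h, Nat.even_add_one]

/-- The alternating product `x y x ⋯` with `n` factors. -/
def altProd : G → G → ℕ → G
  | _, _, 0 => 1
  | x, y, n + 1 => x * altProd y x n

/-- The alternating product `⋯ x y x` with `n` factors. -/
def altProdRev : G → G → ℕ → G
  | _, _, 0 => 1
  | x, y, n + 1 => altProdRev y x n * x

lemma altProd_succ (x y : G) (n : ℕ) : altProd x y (n + 1) = altProd x y n * letter x y n := by
  induction n generalizing x y with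
  | zero => simp [altProd, letter]
  | succ n ih => rw [altProd, ih, letter_succ, ← mul_assoc]; rfl

lemma altProdRev_succ (x y : G) (n : ℕ) :
    altProdRev x y (n + 1) = letter x y n * altProdRev x y n := by
  induction n generalizing x y with
  | zero => simp [altProdRev, letter]
  | succ n ih => rw [altProdRev, ih, letter_succ, mul_assoc]; rfl

variable {H : Type*} [Group H] {s t : H}

/-- The palindrome sts⋯s is its middle letter conjugated by its first half. This identifies the root
of each reflection as a prefix applied to a generator's root. -/
lemma mul_pow_mul_eq_conj (hs : s⁻¹ = s) (ht : t⁻¹ = t) (n : ℕ) :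
    (s * t) ^ n * s = altProd s t n * letter s t n * (altProd s t n)⁻¹ := by
  induction n generalizing s t with
  | zero => simp [altProd, letter]
  | succ n ih =>
    rw [altProd, letter_succ, mul_inv_rev, hs]
    calc (s * t) ^ (n + 1) * s = s * ((t * s) ^ n * t) * s := by
          rw [mul_pow_mul, pow_succ]; simp only [mul_assoc]
      _ = _ := by rw [ih ht hs]; simp only [mul_assoc]

/-- Taking n to be the order of st yields the group braid relation. -/
lemma altProd_eq_pow_mul (hs : s * s = 1) (ht : t * t = 1) (n : ℕ) :
    altProd s t n = (s * t) ^ n * altProd t s n := by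
  induction n generalizing s t with
  | zero => simp [altProd]
  | succ n ih =>
    rw [altProd, altProd, pow_succ, ih ht hs]
    calc s * ((t * s) ^ n * altProd s t n) = (s * t) ^ n * s * altProd s t n := by
          rw [mul_pow_mul, mul_assoc]
      _ = (s * t) ^ n * s * (t * t) * altProd s t n := by rw [ht, mul_one]
      _ = _ := by simp only [mul_assoc]

end Alternating

lemma prod_map_range_telescope {G H : Type*} [Group G] [Monoid H] (L : G →* H) (R T : ℕ → H)
    (g : ℕ → G) (m : ℕ) (h : ∀ n < m, R n = L (g n) * T n * L (g (n + 1))⁻¹) :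
    ((List.range m).map R).prod = L (g 0) * ((List.range m).map T).prod * L (g m)⁻¹ := by
  induction m with
  | zero => simp [← map_mul]
  | succ m ih =>
    have h1 : L (g m)⁻¹ * L (g m) = 1 := by rw [← map_mul]; simp
    simp only [List.range_succ, List.map_append, List.prod_append, List.map_cons, List.map_nil,
      List.prod_singleton]
    rw [ih fun n hn => h n (hn.trans (Nat.lt_succ_self m)), h m (Nat.lt_succ_self m)]
    calc _ = L (g 0) * ((List.range m).map T).prod * (L (g m)⁻¹ * L (g m)) * T m *
          L (g (m + 1))⁻¹ := by simp only [mul_assoc]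
      _ = _ := by rw [h1, mul_one]; simp only [mul_assoc]

/-! ### Hecke operators on the group algebra. -/

section Operators

open Finsupp

variable {ι V N : Type*} [AddCommGroup V] [Module ℝ V] [AddCommGroup N] [Module ℝ N]
  {P : RootPairing ι ℝ V N} {k : Type*} [Field k]

/-- Left multiplication on the span `k[W]`. -/
def leftMul : P.weylGroup →* Module.End k (P.weylGroup →₀ k) where
  toFun g := Finsupp.lmapDomain k k (g * ·)
  map_one' := by ext; simp
  map_mul' g h := by ext; simp [mul_assoc]

lemma leftMul_single (g w : P.weylGroup) (x : k) :
    leftMul g (single w x) = single (g * w) x := by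
  simp [leftMul]

open Classical in
/-- The Hecke operator on `k[W]` attached to a root: it sends `w` to `s w` if `w⁻¹` keeps the root
positive, and to `s w + c w` otherwise. -/
def heckeOp (b : P.Base) (c : k) (i : ι) : Module.End k (P.weylGroup →₀ k) :=
  Finsupp.linearCombination k fun w : P.weylGroup =>
    single (refl P i * w) 1 + if b.IsPos (w⁻¹ • i) then 0 else single w c

open Classical in
lemma heckeOp_single (b : P.Base) (c : k) (i : ι) (w : P.weylGroup) :
    heckeOp b c i (single w 1) =
      single (refl P i * w) 1 + if b.IsPos (w⁻¹ • i) then 0 else single w c := by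
  simp [heckeOp]

lemma heckeOp_single_of_isPos (b : P.Base) (c : k) {i : ι} {w : P.weylGroup}
    (h : b.IsPos (w⁻¹ • i)) : heckeOp b c i (single w 1) = single (refl P i * w) 1 := by
  simp [heckeOp_single, h]

lemma end_ext {f g : Module.End k (P.weylGroup →₀ k)}
    (h : ∀ w, f (single w 1) = g (single w 1)) : f = g := by
  ext w : 2
  simpa using h w

lemma heckeOp_mul_self (b : P.Base) (c : k) (i : ι) :
    heckeOp b c i * heckeOp b c i = 1 + c • heckeOp b c i := by
  refine end_ext fun w => ?_
  have hc (w : P.weylGroup) : single w c = c • single w (1 : k) := by simp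
  have h := isPos_refl_smul_self_iff b w i
  by_cases hw : b.IsPos (w⁻¹ • i)
  · have hw' : ¬ b.IsPos ((refl P i * w)⁻¹ • i) := by rwa [h, not_not]
    rw [Module.End.mul_apply, heckeOp_single_of_isPos b c hw, heckeOp_single, if_neg hw',
      refl_mul_cancel_left, hc, LinearMap.add_apply, LinearMap.smul_apply,
      heckeOp_single_of_isPos b c hw, Module.End.one_apply]
  · have hw' : b.IsPos ((refl P i * w)⁻¹ • i) := h.mpr hw
    rw [Module.End.mul_apply, LinearMap.add_apply, LinearMap.smul_apply, Module.End.one_apply]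
    conv_lhs => rw [heckeOp_single, if_neg hw]
    rw [hc, map_add, map_smul, heckeOp_single_of_isPos b c hw', refl_mul_cancel_left]

/-- With u = (g s_α)⁻¹w, one has g s_α u = w and g u = τw. The extra Hecke term occurs at u exactly
when τ lengthens w, because of the additional s_α; there it raises the coefficient of τw from εq to
εp. -/
lemma one_add_smul_mixedBruhat [Finite ι] [P.IsCrystallographic] [P.IsReduced] (b : P.Base)
    (p q : reflections b → k) (ε : k) (τ : reflections b) (g : P.weylGroup) (i : ι)
    (hτ : (τ : P.weylGroup) = refl P (g • i)) (hpos : b.IsPos (g • i)) :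
    1 + ε • mixedBruhat b p q τ =
      leftMul g * (heckeOp b (ε * (p τ - q τ)) i + (ε * q τ) • 1) * leftMul (g * refl P i)⁻¹ := by
  refine end_ext fun w => ?_
  have hsm (w : P.weylGroup) (c : k) : single w c = c • single w (1 : k) := by simp
  have hl : mixedBruhat b p q τ (single w 1) = single (τ * w)
      (if length b w < length b ((τ : P.weylGroup) * w) then p τ else q τ) := by
    simp [mixedBruhat]
  have e1 : refl P i * ((g * refl P i)⁻¹ * w) = g⁻¹ * w := by group
  have e2 : (g * refl P i)⁻¹ * w = refl P i * (g⁻¹ * w) := by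
    rw [mul_inv_rev, refl_inv, mul_assoc]
  have e3 : (g⁻¹ * w)⁻¹ • i = w⁻¹ • (g • i) := by rw [mul_inv_rev, inv_inv, mul_smul]
  have e4 : g * ((g * refl P i)⁻¹ * w) = τ * w := by
    rw [hτ, refl_smul_index, mul_inv_rev, refl_inv]; group
  have hi : b.IsPos (((g * refl P i)⁻¹ * w)⁻¹ • i) ↔ ¬ b.IsPos (w⁻¹ • (g • i)) := by
    rw [e2, isPos_refl_smul_self_iff, e3]
  have hlen := length_lt_length_refl_mul_iff b w hpos
  rw [← hτ] at hlen
  rw [LinearMap.add_apply, LinearMap.smul_apply, hl, Module.End.mul_apply, Module.End.mul_apply,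
    leftMul_single, LinearMap.add_apply, heckeOp_single, LinearMap.smul_apply, Module.End.one_apply,
    Module.End.one_apply, e1, map_add, map_add, map_smul, leftMul_single, leftMul_single, e4,
    mul_inv_cancel_left]
  by_cases h : b.IsPos (w⁻¹ • (g • i))
  · rw [if_pos (hlen.mpr h), if_neg (by rwa [hi, not_not]), leftMul_single, e4, hsm _ (p τ), hsm _ (ε * _)]
    module
  · rw [if_neg (mt hlen.mp h), if_pos (hi.mpr h), map_zero, hsm _ (q τ)]
    module

/-- Applied to y v, one product gains a letter on its outer end and the other has its inner letter
squared. Both quadratic relations then give the same shorter product plus a multiple of the original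
one. When n is even the outer letter is x rather than y, hence the condition c = d. -/
lemma altProdRev_apply_eq_of_apply_eq {M : Type*} [AddCommGroup M] [Module k M]
    {x y : Module.End k M} {c d : k} (hx : x * x = 1 + c • x) (hy : y * y = 1 + d • y) {n : ℕ}
    (hcd : Even n → c = d) {v : M}
    (hv : altProdRev x y (n + 1) v = altProdRev y x (n + 1) v) :
    altProdRev x y (n + 1) (y v) = altProdRev y x (n + 1) (y v) := by
  have hz : letter x y n * letter x y n = 1 + d • letter x y n := by
    by_cases h : Even n
    · simpa [letter, h, ← hcd h] using hx
    · simpa [letter, h] using hy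
  have h1 : altProdRev x y (n + 1) (y v) = letter x y n (altProdRev y x (n + 1) v) := by
    rw [← Module.End.mul_apply, ← Module.End.mul_apply, ← letter_succ, ← altProdRev_succ]
    rfl
  have h2 : altProdRev y x (n + 1) (y v) =
      altProdRev x y n v + d • altProdRev y x (n + 1) v := by
    have : altProdRev y x (n + 1) * y = altProdRev x y n + d • altProdRev y x (n + 1) := by
      rw [altProdRev, mul_assoc, hy, mul_add, mul_one, mul_smul_comm]
    exact LinearMap.congr_fun this v
  have h3 : letter x y n (altProdRev x y (n + 1) v) =
      altProdRev x y n v + d • altProdRev x y (n + 1) v := by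
    have : letter x y n * altProdRev x y (n + 1) =
        altProdRev x y n + d • altProdRev x y (n + 1) := by
      rw [altProdRev_succ, ← mul_assoc, hz, add_mul, one_mul, smul_mul_assoc]
    exact LinearMap.congr_fun this v
  rw [h1, h2, ← hv, h3]

section Rank2

variable (b : P.Base) {i j : ι}

/-- Height is linear and detects positivity, so real coefficients suffice. -/
lemma isPos_smul_of_nonneg_comb [P.IsRootSystem] {l : ι} {x y : ℝ} (hx : 0 ≤ x) (hy : 0 ≤ y)
    (hl : P.root l = x • P.root i + y • P.root j) {w : P.weylGroup} (hi : b.IsPos (w • i))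
    (hj : b.IsPos (w • j)) : b.IsPos (w • l) := by
  obtain ⟨f, hf⟩ := exists_height_form b
  rw [b.isPos_iff] at hi hj
  rw [b.isPos_iff']
  have h : f (P.root (w • l)) = x * f (P.root (w • i)) + y * f (P.root (w • j)) := by
    simp only [root_smul, hl, smul_add, weylGroup_smul_smul, map_add, map_smul, smul_eq_mul]
  rw [hf, hf, hf] at h
  have h' : (0 : ℝ) ≤ b.height (w • l) := by rw [h]; positivity
  exact_mod_cast h'

/-- The `n`-th root of the sequence `α, s_α β, s_α s_β α, …` -/
def altRoot (P : RootPairing ι ℝ V N) (i j : ι) (n : ℕ) : ι :=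
  altProd (refl P i) (refl P j) n • letter i j n

/-- All members of the sequence `α, s_α β, s_α s_β α, …` up to the `m`-th one are nonnegative
combinations of `α` and `β`. -/
def AltNonneg (P : RootPairing ι ℝ V N) (i j : ι) (m : ℕ) : Prop :=
  ∀ n < m, ∃ x y : ℝ, 0 ≤ x ∧ 0 ≤ y ∧ P.root (altRoot P i j n) = x • P.root i + y • P.root j

lemma refl_letter (n : ℕ) : refl P (letter i j n) = letter (refl P i) (refl P j) n := by
  unfold letter; split_ifs <;> rfl

lemma heckeOp_letter (c d : k) (n : ℕ) : heckeOp b (letter c d n) (letter i j n) =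
    letter (heckeOp b c i) (heckeOp b d j) n := by
  unfold letter; split_ifs <;> rfl

/-- Nonnegativity of the root sequence keeps every Hecke operator in its pure multiplication branch.
-/
lemma altProdRev_heckeOp_single [P.IsRootSystem] (c d : k) {m : ℕ} (hpos : AltNonneg P i j m)
    {w : P.weylGroup} (hi : b.IsPos (w⁻¹ • i)) (hj : b.IsPos (w⁻¹ • j)) {n : ℕ} (hn : n ≤ m) :
    altProdRev (heckeOp b c i) (heckeOp b d j) n (single w 1) =
      single ((altProd (refl P i) (refl P j) n)⁻¹ * w) 1 := by
  induction n with
  | zero => simp [altProdRev, altProd]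
  | succ n ih =>
    obtain ⟨x, y, hx, hy, hxy⟩ := hpos n hn
    have h : b.IsPos (((altProd (refl P i) (refl P j) n)⁻¹ * w)⁻¹ • letter i j n) := by
      rw [mul_inv_rev, inv_inv, mul_smul]
      exact isPos_smul_of_nonneg_comb b hx hy hxy hi hj
    rw [altProdRev_succ, Module.End.mul_apply, ih (Nat.le_of_succ_le hn), ← heckeOp_letter,
      heckeOp_single_of_isPos b _ h, altProd_succ, mul_inv_rev, ← refl_letter, refl_inv, mul_assoc]

/-- The braid relation for the Hecke operators on `k[W]`. -/
lemma heckeOp_braid [Finite ι] [P.IsRootSystem] [P.IsCrystallographic] [P.IsReduced] {c d : k}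
    {n : ℕ} (hcd : Even n → c = d) (hi : b.IsPos i) (hj : b.IsPos j)
    (hij : AltNonneg P i j (n + 1)) (hji : AltNonneg P j i (n + 1))
    (h : altProd (refl P i) (refl P j) (n + 1) = altProd (refl P j) (refl P i) (n + 1)) :
    altProdRev (heckeOp b c i) (heckeOp b d j) (n + 1) =
      altProdRev (heckeOp b d j) (heckeOp b c i) (n + 1) := by
  refine end_ext fun w => ?_
  -- If w⁻¹ makes one of the roots negative, then w = s w' with w' shorter and the basis vector of w
  -- is the Hecke operator of s applied to that of w'. Agreement thus propagates from the elements
  -- for which both roots stay positive.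
  induction hw : length b w using Nat.strong_induction_on generalizing w with
  | _ L ih =>
    subst hw
    by_cases hwi : b.IsPos (w⁻¹ • i)
    · by_cases hwj : b.IsPos (w⁻¹ • j)
      · rw [altProdRev_heckeOp_single b c d hij hwi hwj le_rfl,
          altProdRev_heckeOp_single b d c hji hwj hwi le_rfl, h]
      · have h1 := ih _ (length_refl_mul_lt b hj hwj) _ rfl
        have h2 := altProdRev_apply_eq_of_apply_eq (heckeOp_mul_self b c i)
          (heckeOp_mul_self b d j) hcd h1
        rwa [heckeOp_single_of_isPos b d ((isPos_refl_smul_self_iff b w j).mpr hwj),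
          refl_mul_cancel_left] at h2
    · have h1 := ih _ (length_refl_mul_lt b hi hwi) _ rfl
      have h2 := altProdRev_apply_eq_of_apply_eq (heckeOp_mul_self b d j)
        (heckeOp_mul_self b c i) (fun hn => (hcd hn).symm) h1.symm
      rw [heckeOp_single_of_isPos b c ((isPos_refl_smul_self_iff b w i).mpr hwi),
        refl_mul_cancel_left] at h2
      exact h2.symm

lemma alternating_eq_refl {s t : reflections b} (hs : (s : P.weylGroup) = refl P i)
    (ht : (t : P.weylGroup) = refl P j) (n : ℕ) :
    (alternating b s t n : P.weylGroup) = refl P (altRoot P i j n) := by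
  change ((s : P.weylGroup) * t) ^ n * s = _
  rw [hs, ht, mul_pow_mul_eq_conj (refl_inv i) (refl_inv j), altRoot, refl_smul_index, refl_letter]

/-- The factorization of one side of the Yang-Baxter equation through Hecke operators. -/
lemma ybProduct_eq [Finite ι] [P.IsRootSystem] [P.IsCrystallographic] [P.IsReduced]
    {p q κ : reflections b → k} {F : ι → k} (ε : k)
    (hp : ∀ (τ : reflections b) (l : ι), b.IsPos l → (τ : P.weylGroup) = refl P l →
      p τ - q τ = κ τ)
    (hq : ∀ (τ : reflections b) (l : ι), b.IsPos l → (τ : P.weylGroup) = refl P l →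
      q τ = κ τ * F l)
    {s t : reflections b} (hs : (s : P.weylGroup) = refl P i) (ht : (t : P.weylGroup) = refl P j)
    (hi : b.IsPos i) (hj : b.IsPos j) (hij : AltNonneg P i j (orderOf ((s : P.weylGroup) * t)))
    (hκ : ∀ n < orderOf ((s : P.weylGroup) * t), κ (alternating b s t n) = letter (κ s) (κ t) n) :
    ybProduct b (fun τ => 1 + ε • mixedBruhat b p q τ) s t =
      ((List.range (orderOf ((s : P.weylGroup) * t))).map fun n =>
        letter (heckeOp b (ε * κ s) i) (heckeOp b (ε * κ t) j) n +
          (letter (ε * κ s) (ε * κ t) n * F (altRoot P i j n)) • 1).prod *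
      leftMul (altProd (refl P i) (refl P j) (orderOf ((s : P.weylGroup) * t)))⁻¹ := by
  rw [ybProduct, prod_map_range_telescope leftMul _ _ (altProd (refl P i) (refl P j))]
  · rw [altProd, map_one, one_mul]
  · intro n hn
    obtain ⟨x, y, hx, hy, hxy⟩ := hij n hn
    have hpos : b.IsPos (altRoot P i j n) := by
      simpa using isPos_smul_of_nonneg_comb b hx hy hxy (w := 1) (by simpa) (by simpa)
    have hτ := alternating_eq_refl b hs ht n
    have he : ε * κ (alternating b s t n) = letter (ε * κ s) (ε * κ t) n := by
      rw [hκ n hn]; unfold letter; split_ifs <;> rfl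
    rw [one_add_smul_mixedBruhat b p q ε _ _ _ hτ hpos, hp _ _ hpos hτ, hq _ _ hpos hτ, ← mul_assoc,
      he, altProd_succ, heckeOp_letter, refl_letter, altRoot]

end Rank2

end Operators

/-! ### Orders of products of two reflections. -/

section RankTwoRoots

variable {ι V N : Type*} [AddCommGroup V] [Module ℝ V] [AddCommGroup N] [Module ℝ N]
  {P : RootPairing ι ℝ V N} {i j : ι}

lemma root_altRoot_zero (i j : ι) :
    P.root (altRoot P i j 0) = (1 : ℝ) • P.root i + (0 : ℝ) • P.root j := by
  simp [altRoot, altProd, letter]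

lemma altRoot_succ (i j : ι) (n : ℕ) : altRoot P i j (n + 1) = refl P i • altRoot P j i n := by
  rw [altRoot, altProd, letter_succ, mul_smul, altRoot]

lemma root_altRoot_succ {n : ℕ} {x y z : ℝ}
    (h : P.root (altRoot P j i n) = x • P.root j + y • P.root i) (hz : z = -y - P.pairing j i * x) :
    P.root (altRoot P i j (n + 1)) = z • P.root i + x • P.root j := by
  rw [altRoot_succ, root_smul, h, smul_add, weylGroup_smul_smul, weylGroup_smul_smul,
    refl_smul_root_self, refl_smul_root, hz]
  module

lemma refl_smul_left (v : V) (x y : ℝ) : refl P i • (v + x • P.root i + y • P.root j) =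
    v + (-x - P.pairing j i * y - P.coroot' i v) • P.root i + y • P.root j := by
  rw [smul_add, smul_add, weylGroup_smul_smul, weylGroup_smul_smul,
    refl_smul_root_self, refl_smul_root, refl_smul]
  module

lemma refl_smul_right (v : V) (x y : ℝ) : refl P j • (v + x • P.root i + y • P.root j) =
    v + x • P.root i + (-y - P.pairing i j * x - P.coroot' j v) • P.root j := by
  rw [add_right_comm, refl_smul_left, add_right_comm]

/-- The action of `s_α s_β` on `v + x α + y β` in the coordinates `(x, y)`, where `c = ⟨α, β^∨⟩`,
`d = ⟨β, α^∨⟩`, `e = ⟨v, α^∨⟩` and `f = ⟨v, β^∨⟩`. -/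
def rotation (c d e f : ℝ) (z : ℝ × ℝ) : ℝ × ℝ :=
  (-z.1 - d * (-z.2 - c * z.1 - f) - e, -z.2 - c * z.1 - f)

lemma pow_refl_mul_refl_smul (v : V) (z : ℝ × ℝ) (n : ℕ) :
    (refl P i * refl P j) ^ n • (v + z.1 • P.root i + z.2 • P.root j) =
      v + ((rotation (P.pairing i j) (P.pairing j i) (P.coroot' i v) (P.coroot' j v))^[n] z).1 •
        P.root i +
      ((rotation (P.pairing i j) (P.pairing j i) (P.coroot' i v) (P.coroot' j v))^[n] z).2 •
        P.root j := by
  induction n generalizing z with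
  | zero => simp
  | succ n ih =>
    rw [pow_succ, mul_smul, mul_smul, refl_smul_right, refl_smul_left, Function.iterate_succ_apply]
    exact ih (rotation _ _ _ _ z)

lemma pow_refl_mul_refl_eq_one {m : ℕ}
    (h : ∀ e f : ℝ, (rotation (P.pairing i j) (P.pairing j i) e f)^[m] (0, 0) = (0, 0)) :
    (refl P i * refl P j) ^ m = 1 := by
  refine ext_smul fun v => ?_
  have h1 := pow_refl_mul_refl_smul (P := P) (i := i) (j := j) v (0, 0) m
  rw [h] at h1
  simpa using h1

/-- The parameters e and f range over all reals, so the first condition makes the m-th power fix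
every vector v. For minimality it is enough to follow α itself: smaller powers move it, and
independence makes its coordinates unambiguous. -/
lemma orderOf_refl_mul_refl (hli : LinearIndependent ℝ ![P.root i, P.root j]) {m : ℕ} (hm : 0 < m)
    (h : ∀ e f : ℝ, (rotation (P.pairing i j) (P.pairing j i) e f)^[m] (0, 0) = (0, 0))
    (h' : ∀ n < m, 0 < n →
      (rotation (P.pairing i j) (P.pairing j i) 0 0)^[n] (1, 0) ≠ (1, 0)) :
    orderOf (refl P i * refl P j) = m := by
  rw [orderOf_eq_iff hm]
  refine ⟨pow_refl_mul_refl_eq_one h, fun n hn h0 hw => h' n hn h0 ?_⟩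
  have h1 := pow_refl_mul_refl_smul (P := P) (i := i) (j := j) 0 (1, 0) n
  rw [hw, one_smul, map_zero, map_zero, zero_add, zero_add] at h1
  set z := (rotation (P.pairing i j) (P.pairing j i) 0 0)^[n] (1, 0)
  obtain ⟨h2, h3⟩ := LinearIndependent.pair_iff.mp hli (z.1 - 1) z.2 (by
    rw [← sub_eq_zero.mpr h1.symm]; module)
  exact Prod.ext (sub_eq_zero.mp h2) h3

lemma orderOf_refl_mul_refl_of_pairing_zero (hli : LinearIndependent ℝ ![P.root i, P.root j])
    (hij : P.pairing i j = 0) (hji : P.pairing j i = 0) :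
    orderOf (refl P i * refl P j) = 2 := by
  refine orderOf_refl_mul_refl hli two_pos (fun e f => ?_) (fun n hn h0 => ?_)
  · simp only [hij, hji, Function.iterate_succ_apply, Function.iterate_zero_apply, rotation]
    ext <;> ring
  · interval_cases n; norm_num [hij, hji, rotation]

lemma orderOf_refl_mul_refl_of_pairing_one (hli : LinearIndependent ℝ ![P.root i, P.root j])
    (hij : P.pairing i j = -1) (hji : P.pairing j i = -1) :
    orderOf (refl P i * refl P j) = 3 := by
  refine orderOf_refl_mul_refl hli three_pos (fun e f => ?_) (fun n hn h0 => ?_)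
  · simp only [hij, hji, Function.iterate_succ_apply, Function.iterate_zero_apply, rotation]
    ext <;> ring
  · interval_cases n <;> norm_num [hij, hji, rotation]

lemma orderOf_refl_mul_refl_of_pairing_two (hli : LinearIndependent ℝ ![P.root i, P.root j])
    (hij : P.pairing i j = -1) (hji : P.pairing j i = -2) :
    orderOf (refl P i * refl P j) = 4 := by
  refine orderOf_refl_mul_refl hli four_pos (fun e f => ?_) (fun n hn h0 => ?_)
  · simp only [hij, hji, Function.iterate_succ_apply, Function.iterate_zero_apply, rotation]
    ext <;> ring
  · interval_cases n <;> norm_num [hij, hji, rotation]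

lemma orderOf_refl_mul_refl_of_pairing_three (hli : LinearIndependent ℝ ![P.root i, P.root j])
    (hij : P.pairing i j = -1) (hji : P.pairing j i = -3) :
    orderOf (refl P i * refl P j) = 6 := by
  refine orderOf_refl_mul_refl hli (by norm_num) (fun e f => ?_) (fun n hn h0 => ?_)
  · simp only [hij, hji, Function.iterate_succ_apply, Function.iterate_zero_apply, rotation]
    ext <;> ring
  · interval_cases n <;> norm_num [hij, hji, rotation]

end RankTwoRoots

/-! ### The Yang–Baxter equation in each rank-two type. -/

section RankTwo

variable {ι V N : Type*} [AddCommGroup V] [Module ℝ V] [AddCommGroup N] [Module ℝ N]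
  {P : RootPairing ι ℝ V N} {k : Type*} [Field k]

/-- The data entering the Yang-Baxter equations: the parameters `p`, `q` of the mixed Bruhat
operators are `κ (1 + F)` and `κ F`, where `F` satisfies the functional equation of
`E₂ / (E₁ - E₂)`. -/
structure IsBaxterDatum (b : P.Base) (B : P.InvariantForm) (p q κ : reflections b → k)
    (F : ι → k) : Prop where
  sub_eq (τ : reflections b) (l : ι) (hl : b.IsPos l) (h : (τ : P.weylGroup) = refl P l) :
    p τ - q τ = κ τ
  eq_mul (τ : reflections b) (l : ι) (hl : b.IsPos l) (h : (τ : P.weylGroup) = refl P l) :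
    q τ = κ τ * F l
  length_eq (τ σ : reflections b) (l l' : ι) (hl : b.IsPos l) (hl' : b.IsPos l')
    (h : (τ : P.weylGroup) = refl P l) (h' : (σ : P.weylGroup) = refl P l')
    (hB : B.form (P.root l) (P.root l) = B.form (P.root l') (P.root l')) : κ τ = κ σ
  add_eq (l l₁ l₂ : ι) (hl : b.IsPos l) (h₁ : b.IsPos l₁) (h₂ : b.IsPos l₂)
    (h : P.root l = P.root l₁ + P.root l₂) : F l * (1 + F l₁ + F l₂) = F l₁ * F l₂

lemma AltNonneg.isPos [P.IsRootSystem] {b : P.Base} {i j : ι} {m n : ℕ} (h : AltNonneg P i j m)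
    (hn : n < m) (hi : b.IsPos i) (hj : b.IsPos j) : b.IsPos (altRoot P i j n) := by
  obtain ⟨x, y, hx, hy, hxy⟩ := h n hn
  simpa using isPos_smul_of_nonneg_comb b hx hy hxy (w := 1) (by simpa) (by simpa)

variable [Finite ι] [P.IsRootSystem] [P.IsCrystallographic] [P.IsReduced]
  {b : P.Base} {B : P.InvariantForm} {p q κ : reflections b → k} {F : ι → k} {i j : ι}

omit [Finite ι] [P.IsCrystallographic] [P.IsReduced] in
-- Each root in the sequence is a Weyl group translate of one of the two generating roots,
-- alternately, and the form is invariant.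
lemma IsBaxterDatum.alternating_eq (D : IsBaxterDatum b B p q κ F) {s t : reflections b}
    (hs : (s : P.weylGroup) = refl P i) (ht : (t : P.weylGroup) = refl P j)
    (hi : b.IsPos i) (hj : b.IsPos j) {m n : ℕ} (hij : AltNonneg P i j m) (hn : n < m) :
    κ (alternating b s t n) = letter (κ s) (κ t) n := by
  have hτ := alternating_eq_refl b hs ht n
  have hpos := hij.isPos hn hi hj
  have hB : B.form (P.root (altRoot P i j n)) (P.root (altRoot P i j n)) =
      B.form (P.root (letter i j n)) (P.root (letter i j n)) := by
    rw [altRoot, root_smul, B.apply_weylGroup_smul]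
  by_cases h : Even n
  · simp only [letter, h, if_true] at hB ⊢
    exact D.length_eq _ _ _ _ hpos hi hτ hs hB
  · simp only [letter, h, if_false] at hB ⊢
    exact D.length_eq _ _ _ _ hpos hj hτ ht hB

/-- Reduction of the Yang-Baxter equation to an identity in the Hecke algebra of rank two. -/
lemma ybProduct_comm_of_baxter (D : IsBaxterDatum b B p q κ F) (ε : k) {s t : reflections b}
    (hs : (s : P.weylGroup) = refl P i) (ht : (t : P.weylGroup) = refl P j)
    (hi : b.IsPos i) (hj : b.IsPos j) {n : ℕ} (hord : orderOf (refl P i * refl P j) = n + 1)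
    (hij : AltNonneg P i j (n + 1)) (hji : AltNonneg P j i (n + 1))
    (hκ : Even n → κ s = κ t)
    (hYB : ∀ (S T : Module.End k (P.weylGroup →₀ k)) (c d : k), S * S = 1 + c • S →
      T * T = 1 + d • T → altProdRev S T (n + 1) = altProdRev T S (n + 1) → (Even n → c = d) →
      ((List.range (n + 1)).map fun l =>
        letter S T l + (letter c d l * F (altRoot P i j l)) • 1).prod =
      ((List.range (n + 1)).map fun l =>
        letter T S l + (letter d c l * F (altRoot P j i l)) • 1).prod) :
    ybProduct b (fun τ => 1 + ε • mixedBruhat b p q τ) s t =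
      ybProduct b (fun τ => 1 + ε • mixedBruhat b p q τ) t s := by
  have hord' : orderOf (refl P j * refl P i) = n + 1 := by
    rw [← orderOf_inv, mul_inv_rev, refl_inv, refl_inv, hord]
  have hst : orderOf ((s : P.weylGroup) * t) = n + 1 := by rw [hs, ht, hord]
  have hts : orderOf ((t : P.weylGroup) * s) = n + 1 := by rw [hs, ht, hord']
  have hcd : Even n → ε * κ s = ε * κ t := fun h => by rw [hκ h]
  have hbraid : altProd (refl P i) (refl P j) (n + 1) = altProd (refl P j) (refl P i) (n + 1) := by
    rw [altProd_eq_pow_mul (refl_mul_self i) (refl_mul_self j), ← hord, pow_orderOf_eq_one, one_mul]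
  rw [ybProduct_eq b ε D.sub_eq D.eq_mul hs ht hi hj (hst ▸ hij)
      fun l hl => D.alternating_eq hs ht hi hj hij (hst ▸ hl),
    ybProduct_eq b ε D.sub_eq D.eq_mul ht hs hj hi (hts ▸ hji)
      fun l hl => D.alternating_eq ht hs hj hi hji (hts ▸ hl), hst, hts, hbraid]
  -- By `hbraid` both sides end in the same translation, which is removed here.
  congr 1
  exact hYB _ _ _ _ (heckeOp_mul_self b _ i) (heckeOp_mul_self b _ j)
    (heckeOp_braid b hcd hi hj hij hji hbraid) hcd

lemma ybProduct_comm_of_pairing_zero (D : IsBaxterDatum b B p q κ F) (ε : k) {s t : reflections b}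
    (hs : (s : P.weylGroup) = refl P i) (ht : (t : P.weylGroup) = refl P j)
    (hi : b.IsPos i) (hj : b.IsPos j) (hli : LinearIndependent ℝ ![P.root i, P.root j])
    (hpij : P.pairing i j = 0) (hpji : P.pairing j i = 0) :
    ybProduct b (fun τ => 1 + ε • mixedBruhat b p q τ) s t =
      ybProduct b (fun τ => 1 + ε • mixedBruhat b p q τ) t s := by
  have i₀ := root_altRoot_zero (P := P) i j
  have j₀ := root_altRoot_zero (P := P) j i
  have i₁ := root_altRoot_succ (z := 0) j₀ (by rw [hpji]; norm_num)
  have j₁ := root_altRoot_succ (z := 0) i₀ (by rw [hpij]; norm_num)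
  have hij : AltNonneg P i j 2 := by
    intro n hn
    interval_cases n
    exacts [⟨_, _, by norm_num, by norm_num, i₀⟩, ⟨_, _, by norm_num, by norm_num, i₁⟩]
  have hji : AltNonneg P j i 2 := by
    intro n hn
    interval_cases n
    exacts [⟨_, _, by norm_num, by norm_num, j₀⟩, ⟨_, _, by norm_num, by norm_num, j₁⟩]
  have e₀ : altRoot P j i 0 = altRoot P i j 1 := P.root.injective (by rw [j₀, i₁]; module)
  have e₁ : altRoot P j i 1 = altRoot P i j 0 := P.root.injective (by rw [j₁, i₀]; module)
  refine ybProduct_comm_of_baxter D ε hs ht hi hj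
    (orderOf_refl_mul_refl_of_pairing_zero hli hpij hpji) hij hji
    (fun h => absurd h (by decide)) ?_
  intro S T c d hS hT hST hcd
  simp only [altProdRev, one_mul] at hST
  have h0 : Even 0 := by decide
  have h1 : ¬ Even 1 := by decide
  simp only [List.range_succ, List.range_zero, List.nil_append, List.map_cons, List.map_nil,
    List.prod_cons, List.prod_nil, List.cons_append, mul_one, letter, h0, h1, if_true, if_false,
    e₀, e₁]
  exact baxter_two (a := S) (b := T) hST.symm _ _

lemma ybProduct_comm_of_pairing_one (D : IsBaxterDatum b B p q κ F) (ε : k) {s t : reflections b}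
    (hs : (s : P.weylGroup) = refl P i) (ht : (t : P.weylGroup) = refl P j)
    (hi : b.IsPos i) (hj : b.IsPos j) (hli : LinearIndependent ℝ ![P.root i, P.root j])
    (hpij : P.pairing i j = -1) (hpji : P.pairing j i = -1) :
    ybProduct b (fun τ => 1 + ε • mixedBruhat b p q τ) s t =
      ybProduct b (fun τ => 1 + ε • mixedBruhat b p q τ) t s := by
  have i₀ := root_altRoot_zero (P := P) i j
  have j₀ := root_altRoot_zero (P := P) j i
  have i₁ := root_altRoot_succ (z := 1) j₀ (by rw [hpji]; norm_num)
  have j₁ := root_altRoot_succ (z := 1) i₀ (by rw [hpij]; norm_num)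
  have i₂ := root_altRoot_succ (z := 0) j₁ (by rw [hpji]; norm_num)
  have j₂ := root_altRoot_succ (z := 0) i₁ (by rw [hpij]; norm_num)
  have hij : AltNonneg P i j 3 := by
    intro n hn
    interval_cases n
    exacts [⟨_, _, by norm_num, by norm_num, i₀⟩, ⟨_, _, by norm_num, by norm_num, i₁⟩,
      ⟨_, _, by norm_num, by norm_num, i₂⟩]
  have hji : AltNonneg P j i 3 := by
    intro n hn
    interval_cases n
    exacts [⟨_, _, by norm_num, by norm_num, j₀⟩, ⟨_, _, by norm_num, by norm_num, j₁⟩,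
      ⟨_, _, by norm_num, by norm_num, j₂⟩]
  have hpos (n : ℕ) (hn : n < 3) : b.IsPos (altRoot P i j n) := hij.isPos hn hi hj
  have e₀ : altRoot P j i 0 = altRoot P i j 2 := P.root.injective (by rw [j₀, i₂]; module)
  have e₁ : altRoot P j i 1 = altRoot P i j 1 := P.root.injective (by rw [j₁, i₁]; module)
  have e₂ : altRoot P j i 2 = altRoot P i j 0 := P.root.injective (by rw [j₂, i₀]; module)
  have f₀₂ := D.add_eq (altRoot P i j 1) (altRoot P i j 0) (altRoot P i j 2)
    (hpos _ (by norm_num)) (hpos _ (by norm_num)) (hpos _ (by norm_num))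
    (by rw [i₀, i₁, i₂]; module)
  -- Here m = 3 is odd, so both generators must carry the same κ; equal pairings force equal
  -- lengths.
  have hlen : B.form (P.root i) (P.root i) = B.form (P.root j) (P.root j) := by
    have := B.pairing_mul_eq_pairing_mul_swap i j
    rw [hpij, hpji] at this
    linarith
  refine ybProduct_comm_of_baxter D ε hs ht hi hj
    (orderOf_refl_mul_refl_of_pairing_one hli hpij hpji) hij hji
    (fun _ => D.length_eq s t i j hi hj hs ht hlen) ?_
  intro S T c d hS hT hST hcd
  obtain rfl := hcd (by decide)
  simp only [altProdRev, one_mul, mul_assoc] at hST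
  have h0 : Even 0 := by decide
  have h1 : ¬ Even 1 := by decide
  have h2 : Even 2 := by decide
  simp only [List.range_succ, List.range_zero, List.nil_append, List.map_cons, List.map_nil,
    List.prod_cons, List.prod_nil, List.cons_append, mul_one, letter, h0, h1, h2, if_true, if_false,
    e₀, e₁, e₂]
  exact baxter_three (a := S) (b := T) hS hT hST f₀₂

/-- Type B₂ with α short: the roots occur in the order α, 2α+β, α+β, β, and in reverse when the
generators are swapped. -/
lemma ybProduct_comm_of_pairing_two (D : IsBaxterDatum b B p q κ F) (ε : k) {s t : reflections b}
    (hs : (s : P.weylGroup) = refl P i) (ht : (t : P.weylGroup) = refl P j)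
    (hi : b.IsPos i) (hj : b.IsPos j) (hli : LinearIndependent ℝ ![P.root i, P.root j])
    (hpij : P.pairing i j = -1) (hpji : P.pairing j i = -2) :
    ybProduct b (fun τ => 1 + ε • mixedBruhat b p q τ) s t =
      ybProduct b (fun τ => 1 + ε • mixedBruhat b p q τ) t s := by
  have i₀ := root_altRoot_zero (P := P) i j
  have j₀ := root_altRoot_zero (P := P) j i
  have i₁ := root_altRoot_succ (z := 2) j₀ (by rw [hpji]; norm_num)
  have j₁ := root_altRoot_succ (z := 1) i₀ (by rw [hpij]; norm_num)
  have i₂ := root_altRoot_succ (z := 1) j₁ (by rw [hpji]; norm_num)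
  have j₂ := root_altRoot_succ (z := 1) i₁ (by rw [hpij]; norm_num)
  have i₃ := root_altRoot_succ (z := 0) j₂ (by rw [hpji]; norm_num)
  have j₃ := root_altRoot_succ (z := 0) i₂ (by rw [hpij]; norm_num)
  have hij : AltNonneg P i j 4 := by
    intro n hn
    interval_cases n
    exacts [⟨_, _, by norm_num, by norm_num, i₀⟩, ⟨_, _, by norm_num, by norm_num, i₁⟩,
      ⟨_, _, by norm_num, by norm_num, i₂⟩, ⟨_, _, by norm_num, by norm_num, i₃⟩]
  have hji : AltNonneg P j i 4 := by
    intro n hn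
    interval_cases n
    exacts [⟨_, _, by norm_num, by norm_num, j₀⟩, ⟨_, _, by norm_num, by norm_num, j₁⟩,
      ⟨_, _, by norm_num, by norm_num, j₂⟩, ⟨_, _, by norm_num, by norm_num, j₃⟩]
  have hpos (n : ℕ) (hn : n < 4) : b.IsPos (altRoot P i j n) := hij.isPos hn hi hj
  have e₀ : altRoot P j i 0 = altRoot P i j 3 := P.root.injective (by rw [j₀, i₃]; module)
  have e₁ : altRoot P j i 1 = altRoot P i j 2 := P.root.injective (by rw [j₁, i₂]; module)
  have e₂ : altRoot P j i 2 = altRoot P i j 1 := P.root.injective (by rw [j₂, i₁]; module)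
  have e₃ : altRoot P j i 3 = altRoot P i j 0 := P.root.injective (by rw [j₃, i₀]; module)
  have f₀₂ := D.add_eq (altRoot P i j 1) (altRoot P i j 0) (altRoot P i j 2)
    (hpos _ (by norm_num)) (hpos _ (by norm_num)) (hpos _ (by norm_num))
    (by rw [i₀, i₁, i₂]; module)
  have f₀₃ := D.add_eq (altRoot P i j 2) (altRoot P i j 0) (altRoot P i j 3)
    (hpos _ (by norm_num)) (hpos _ (by norm_num)) (hpos _ (by norm_num))
    (by rw [i₀, i₂, i₃]; module)
  refine ybProduct_comm_of_baxter D ε hs ht hi hj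
    (orderOf_refl_mul_refl_of_pairing_two hli hpij hpji) hij hji
    (fun h => absurd h (by decide)) ?_
  intro S T c d hS hT hST hcd
  simp only [altProdRev, one_mul, mul_assoc] at hST
  have h0 : Even 0 := by decide
  have h1 : ¬ Even 1 := by decide
  have h2 : Even 2 := by decide
  have h3 : ¬ Even 3 := by decide
  simp only [List.range_succ, List.range_zero, List.nil_append, List.map_cons, List.map_nil,
    List.prod_cons, List.prod_nil, List.cons_append, mul_one, letter, h0, h1, h2, h3, if_true,
    if_false, e₀, e₁, e₂, e₃]
  exact baxter_four (a := S) (b := T) hS hT hST.symm f₀₂ f₀₃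

/-- Type G₂ with α short: the order is α, 3α+β, 2α+β, 3α+2β, α+β, β. The five additive relations
extracted are those used by `baxter_six`. -/
lemma ybProduct_comm_of_pairing_three (D : IsBaxterDatum b B p q κ F) (ε : k)
    {s t : reflections b}
    (hs : (s : P.weylGroup) = refl P i) (ht : (t : P.weylGroup) = refl P j)
    (hi : b.IsPos i) (hj : b.IsPos j) (hli : LinearIndependent ℝ ![P.root i, P.root j])
    (hpij : P.pairing i j = -1) (hpji : P.pairing j i = -3) :
    ybProduct b (fun τ => 1 + ε • mixedBruhat b p q τ) s t =
      ybProduct b (fun τ => 1 + ε • mixedBruhat b p q τ) t s := by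
  have i₀ := root_altRoot_zero (P := P) i j
  have j₀ := root_altRoot_zero (P := P) j i
  have i₁ := root_altRoot_succ (z := 3) j₀ (by rw [hpji]; norm_num)
  have j₁ := root_altRoot_succ (z := 1) i₀ (by rw [hpij]; norm_num)
  have i₂ := root_altRoot_succ (z := 2) j₁ (by rw [hpji]; norm_num)
  have j₂ := root_altRoot_succ (z := 2) i₁ (by rw [hpij]; norm_num)
  have i₃ := root_altRoot_succ (z := 3) j₂ (by rw [hpji]; norm_num)
  have j₃ := root_altRoot_succ (z := 1) i₂ (by rw [hpij]; norm_num)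
  have i₄ := root_altRoot_succ (z := 1) j₃ (by rw [hpji]; norm_num)
  have j₄ := root_altRoot_succ (z := 1) i₃ (by rw [hpij]; norm_num)
  have i₅ := root_altRoot_succ (z := 0) j₄ (by rw [hpji]; norm_num)
  have j₅ := root_altRoot_succ (z := 0) i₄ (by rw [hpij]; norm_num)
  have hij : AltNonneg P i j 6 := by
    intro n hn
    interval_cases n
    exacts [⟨_, _, by norm_num, by norm_num, i₀⟩, ⟨_, _, by norm_num, by norm_num, i₁⟩,
      ⟨_, _, by norm_num, by norm_num, i₂⟩, ⟨_, _, by norm_num, by norm_num, i₃⟩,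
      ⟨_, _, by norm_num, by norm_num, i₄⟩, ⟨_, _, by norm_num, by norm_num, i₅⟩]
  have hji : AltNonneg P j i 6 := by
    intro n hn
    interval_cases n
    exacts [⟨_, _, by norm_num, by norm_num, j₀⟩, ⟨_, _, by norm_num, by norm_num, j₁⟩,
      ⟨_, _, by norm_num, by norm_num, j₂⟩, ⟨_, _, by norm_num, by norm_num, j₃⟩,
      ⟨_, _, by norm_num, by norm_num, j₄⟩, ⟨_, _, by norm_num, by norm_num, j₅⟩]
  have hpos (n : ℕ) (hn : n < 6) : b.IsPos (altRoot P i j n) := hij.isPos hn hi hj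
  have e₀ : altRoot P j i 0 = altRoot P i j 5 := P.root.injective (by rw [j₀, i₅]; module)
  have e₁ : altRoot P j i 1 = altRoot P i j 4 := P.root.injective (by rw [j₁, i₄]; module)
  have e₂ : altRoot P j i 2 = altRoot P i j 3 := P.root.injective (by rw [j₂, i₃]; module)
  have e₃ : altRoot P j i 3 = altRoot P i j 2 := P.root.injective (by rw [j₃, i₂]; module)
  have e₄ : altRoot P j i 4 = altRoot P i j 1 := P.root.injective (by rw [j₄, i₁]; module)
  have e₅ : altRoot P j i 5 = altRoot P i j 0 := P.root.injective (by rw [j₅, i₀]; module)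
  have f₀₄ := D.add_eq (altRoot P i j 2) (altRoot P i j 0) (altRoot P i j 4)
    (hpos _ (by norm_num)) (hpos _ (by norm_num)) (hpos _ (by norm_num))
    (by rw [i₀, i₂, i₄]; module)
  have f₀₂ := D.add_eq (altRoot P i j 1) (altRoot P i j 0) (altRoot P i j 2)
    (hpos _ (by norm_num)) (hpos _ (by norm_num)) (hpos _ (by norm_num))
    (by rw [i₀, i₁, i₂]; module)
  have f₂₄ := D.add_eq (altRoot P i j 3) (altRoot P i j 2) (altRoot P i j 4)
    (hpos _ (by norm_num)) (hpos _ (by norm_num)) (hpos _ (by norm_num))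
    (by rw [i₂, i₃, i₄]; module)
  have f₀₅ := D.add_eq (altRoot P i j 4) (altRoot P i j 0) (altRoot P i j 5)
    (hpos _ (by norm_num)) (hpos _ (by norm_num)) (hpos _ (by norm_num))
    (by rw [i₀, i₄, i₅]; module)
  have f₁₅ := D.add_eq (altRoot P i j 3) (altRoot P i j 1) (altRoot P i j 5)
    (hpos _ (by norm_num)) (hpos _ (by norm_num)) (hpos _ (by norm_num))
    (by rw [i₁, i₃, i₅]; module)
  refine ybProduct_comm_of_baxter D ε hs ht hi hj
    (orderOf_refl_mul_refl_of_pairing_three hli hpij hpji) hij hji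
    (fun h => absurd h (by decide)) ?_
  intro S T c d hS hT hST hcd
  simp only [altProdRev, one_mul, mul_assoc] at hST
  have h0 : Even 0 := by decide
  have h1 : ¬ Even 1 := by decide
  have h2 : Even 2 := by decide
  have h3 : ¬ Even 3 := by decide
  have h4 : Even 4 := by decide
  have h5 : ¬ Even 5 := by decide
  simp only [List.range_succ, List.range_zero, List.nil_append, List.map_cons, List.map_nil,
    List.prod_cons, List.prod_nil, List.cons_append, mul_one, letter, h0, h1, h2, h3, h4, h5,
    if_true, if_false, e₀, e₁, e₂, e₃, e₄, e₅]
  exact baxter_six (a := S) (b := T) hS hT hST.symm f₀₄ f₀₂ f₂₄ f₀₅ f₁₅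

end RankTwo

/-! ### Canonical generators and the four rank-two types. -/

section DihedralSubgroup

variable {ι V N : Type*} [AddCommGroup V] [Module ℝ V] [AddCommGroup N] [Module ℝ N]
  {P : RootPairing ι ℝ V N} {b : P.Base} {W' : Subgroup P.weylGroup} {i j l : ι}

/-- If the difference were a root of the subsystem, it or its negative would be positive, and one of
the two simple roots would decompose. -/
lemma root_sub_ne_of_subsystemSimple (hi : i ∈ subsystemSimple b W')
    (hj : j ∈ subsystemSimple b W') (hl : refl P l ∈ W') :
    P.root l ≠ P.root i - P.root j := by
  intro h
  rcases RootPairing.Base.IsPos.or_neg b l with hpos | hneg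
  · exact hi.2 ⟨l, ⟨hpos, hl⟩, j, hj.1, by rw [h]; abel⟩
  · refine hj.2 ⟨refl P l • l, ⟨hneg, ?_⟩, i, hi.1, ?_⟩
    · rw [refl_smul_index]
      exact mul_mem (mul_mem hl hl) (inv_mem hl)
    · rw [root_smul, refl_smul_root_self, h]; abel

lemma refl_smul_mem (hi : refl P i ∈ W') (hj : refl P j ∈ W') : refl P (refl P j • i) ∈ W' := by
  rw [refl_smul_index]
  exact mul_mem (mul_mem hj hi) (inv_mem hj)

variable [Finite ι] [P.IsCrystallographic] [P.IsReduced]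

omit [Finite ι] [P.IsCrystallographic] in
lemma linearIndependent_of_isPos (hi : b.IsPos i) (hj : b.IsPos j) (hij : i ≠ j) :
    LinearIndependent ℝ ![P.root i, P.root j] := by
  refine RootPairing.IsReduced.linearIndependent P hij fun h => ?_
  have h' : P.root i = P.root (refl P j • j) := by rw [root_smul, refl_smul_root_self, h]
  have h'' : i = refl P j • j := P.root.injective h'
  have hneg : b.IsPos (refl P j • j) := h'' ▸ hi
  exact (RootPairing.Base.IsPos.neg_iff_not b j).mp hneg hj

/-- The possible values of the pairings between two simple roots of a root subsystem. -/
lemma pairing_mem_of_subsystemSimple (hi : i ∈ subsystemSimple b W')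
    (hj : j ∈ subsystemSimple b W') (hij : i ≠ j) :
    (P.pairing i j, P.pairing j i) ∈
      ({(0, 0), (-1, -1), (-1, -2), (-2, -1), (-1, -3), (-3, -1)} : Set (ℝ × ℝ)) := by
  have hli := linearIndependent_of_isPos hi.1.1 hj.1.1 hij
  have hne : P.root i ≠ -P.root j := by
    intro h
    have := (LinearIndependent.pair_iff.mp hli) 1 1 (by rw [h]; module)
    norm_num at this
  have h1 : P.pairing i j ≠ 1 := by
    intro h
    refine root_sub_ne_of_subsystemSimple hi hj (refl_smul_mem hi.1.2 hj.1.2) ?_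
    rw [root_smul, refl_smul_root, h, one_smul]
  have h2 : P.pairing j i ≠ 1 := by
    intro h
    refine root_sub_ne_of_subsystemSimple hj hi (refl_smul_mem hj.1.2 hi.1.2) ?_
    rw [root_smul, refl_smul_root, h, one_smul]
  -- Of the integer pairs allowed for non-proportional roots, every positive one contains an entry
  -- 1, and `h1` and `h2` exclude it.
  have h := P.pairingIn_pairingIn_mem_set_of_isCrystal_of_isRed' i j (by simpa using hij) hne
  rw [← P.algebraMap_pairingIn ℤ] at h1 h2 ⊢
  rw [← P.algebraMap_pairingIn ℤ]
  simp only [Set.mem_insert_iff, Set.mem_singleton_iff, Prod.mk.injEq] at h ⊢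
  generalize P.pairingIn ℤ i j = x at *
  generalize P.pairingIn ℤ j i = y at *
  rcases h with ⟨rfl, rfl⟩ | ⟨rfl, rfl⟩ | ⟨rfl, rfl⟩ | ⟨rfl, rfl⟩ | ⟨rfl, rfl⟩ | ⟨rfl, rfl⟩ |
    ⟨rfl, rfl⟩ | ⟨rfl, rfl⟩ | ⟨rfl, rfl⟩ | ⟨rfl, rfl⟩ | ⟨rfl, rfl⟩ <;> norm_num at *

variable {k : Type*} [Field k] [P.IsRootSystem]

lemma IsBaxterDatum.isYangBaxterSolution {B : P.InvariantForm} {p q κ : reflections b → k}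
    {F : ι → k} (D : IsBaxterDatum b B p q κ F) (ε : k) :
    IsYangBaxterSolution b (fun τ => 1 + ε • mixedBruhat b p q τ) := by
  rintro W' s t ⟨-, hne, hst⟩
  obtain ⟨i, hi, hs⟩ : (s : P.weylGroup) ∈ canonicalGenerators b W' := by rw [hst]; simp
  obtain ⟨j, hj, ht⟩ : (t : P.weylGroup) ∈ canonicalGenerators b W' := by rw [hst]; simp
  have hij : i ≠ j := by
    rintro rfl
    exact hne (hs.symm.trans ht)
  have hli := linearIndependent_of_isPos hi.1.1 hj.1.1 hij
  have hli' := linearIndependent_of_isPos hj.1.1 hi.1.1 hij.symm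
  have h := pairing_mem_of_subsystemSimple hi hj hij
  simp only [Set.mem_insert_iff, Set.mem_singleton_iff, Prod.mk.injEq] at h
  rcases h with ⟨h, h'⟩ | ⟨h, h'⟩ | ⟨h, h'⟩ | ⟨h, h'⟩ | ⟨h, h'⟩ | ⟨h, h'⟩
  · exact ybProduct_comm_of_pairing_zero D ε hs.symm ht.symm hi.1.1 hj.1.1 hli h h'
  · exact ybProduct_comm_of_pairing_one D ε hs.symm ht.symm hi.1.1 hj.1.1 hli h h'
  · exact ybProduct_comm_of_pairing_two D ε hs.symm ht.symm hi.1.1 hj.1.1 hli h h'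
  · exact (ybProduct_comm_of_pairing_two D ε ht.symm hs.symm hj.1.1 hi.1.1 hli' h' h).symm
  · exact ybProduct_comm_of_pairing_three D ε hs.symm ht.symm hi.1.1 hj.1.1 hli h h'
  · exact (ybProduct_comm_of_pairing_three D ε ht.symm hs.symm hj.1.1 hi.1.1 hli' h' h).symm

end DihedralSubgroup

/-! ### From scalar values to a formal variable. -/

section FormalVariable

open Polynomial

variable {k : Type*} [Field k] {M : Type*} [AddCommGroup M] [Module k M]

/-- Evaluation of polynomials with operator coefficients at a scalar. -/
def evalScalar (ε : k) : (Module.End k M)[X] →+* Module.End k M :=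
  Polynomial.eval₂RingHom' (RingHom.id _) (algebraMap k (Module.End k M) ε)
    fun a => (Algebra.commutes ε a).symm

lemma evalScalar_eq_sum (ε : k) (f : (Module.End k M)[X]) :
    evalScalar ε f = ∑ n ∈ Finset.range (f.natDegree + 1), ε ^ n • f.coeff n := by
  change eval₂ (RingHom.id _) _ f = _
  rw [eval₂_eq_sum_range]
  refine Finset.sum_congr rfl fun n _ => ?_
  rw [RingHom.id_apply, ← map_pow, ← Algebra.commutes, Algebra.smul_def]

/-- A nonzero coefficient is detected by some vector and linear functional. Pairing with them gives
an ordinary polynomial that vanishes on the infinite field k. -/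
lemma eq_zero_of_evalScalar [Infinite k] {f : (Module.End k M)[X]}
    (h : ∀ ε : k, evalScalar ε f = 0) : f = 0 := by
  ext n v
  by_contra hv
  obtain ⟨φ, hφ⟩ : ∃ φ : Module.Dual k M, φ (f.coeff n v) ≠ 0 := by
    by_contra! hc
    exact hv ((Module.forall_dual_apply_eq_zero_iff k _).mp hc)
  let g : k[X] := ∑ n ∈ Finset.range (f.natDegree + 1), monomial n (φ (f.coeff n v))
  have hg : g = 0 := by
    refine Polynomial.funext fun ε => ?_
    have h1 := congr_arg φ (LinearMap.congr_fun (h ε) v)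
    rw [evalScalar_eq_sum] at h1
    simpa [g, eval_finsetSum, LinearMap.sum_apply, mul_comm] using h1
  have hn : n < f.natDegree + 1 := by
    rw [Nat.lt_succ_iff]
    refine le_natDegree_of_ne_zero fun h0 => hv ?_
    simp [h0]
  have := congr_arg (fun r => r.coeff n) hg
  simp [g, coeff_monomial] at this
  exact hφ (this (by omega))

lemma eq_of_evalScalar [Infinite k] {f g : (Module.End k M)[X]}
    (h : ∀ ε : k, evalScalar ε f = evalScalar ε g) : f = g :=
  sub_eq_zero.mp (eq_zero_of_evalScalar fun ε => by rw [map_sub, h, sub_self])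

lemma evalScalar_one_add (ε : k) (f : Module.End k M) :
    evalScalar ε (1 + X * C f) = 1 + ε • f := by
  have hX : evalScalar ε (X : (Module.End k M)[X]) = algebraMap k _ ε := eval₂_X _ _
  have hC : evalScalar ε (C f) = f := eval₂_C _ _
  rw [map_add, map_one, map_mul, hX, hC, Algebra.smul_def]

variable {ι V N : Type*} [AddCommGroup V] [Module ℝ V] [AddCommGroup N] [Module ℝ N]
  {P : RootPairing ι ℝ V N}

lemma map_ybProduct {G H : Type*} [Monoid G] [Monoid H] (φ : G →* H) (b : P.Base)
    (R : reflections b → G) (s t : reflections b) :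
    φ (ybProduct b R s t) = ybProduct b (fun τ => φ (R τ)) s t := by
  rw [ybProduct, map_list_prod, List.map_map]
  rfl

/-- A Yang-Baxter solution depending on a formal variable is the same as one for all of its
values. -/
lemma isYangBaxterSolution_polynomial [Infinite k] (b : P.Base)
    (R : reflections b → Module.End k M)
    (h : ∀ ε : k, IsYangBaxterSolution b fun τ => 1 + ε • R τ) :
    IsYangBaxterSolution b fun τ => (1 + X * C (R τ) : (Module.End k M)[X]) := by
  intro W' s t hst
  refine eq_of_evalScalar fun ε => ?_
  have h' (s t : reflections b) : evalScalar ε (ybProduct b (fun τ => 1 + X * C (R τ)) s t) =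
      ybProduct b (fun τ => 1 + ε • R τ) s t := by
    refine (map_ybProduct (evalScalar ε : _ →+* _).toMonoidHom b _ s t).trans ?_
    congr 1
    exact funext fun τ => evalScalar_one_add ε (R τ)
  rw [h', h']
  exact h ε W' s t hst

end FormalVariable

/-! ### The functional equation from multiplicativity. -/

section Multiplicative

variable {ι V N : Type*} [AddCommGroup V] [Module ℝ V] [AddCommGroup N] [Module ℝ N]
  {P : RootPairing ι ℝ V N} {k : Type*} [Field k]

/-- For F = y/(x - y) the ratio F/(1 + F) is y/x, hence multiplicative. Cross-multiplying gives
F₁₂(1 + F₁)(1 + F₂) = F₁F₂(1 + F₁₂), which remains valid when some x or y is 0. -/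
lemma functional_equation {x₁ x₂ y₁ y₂ : k} (h₁ : x₁ ≠ y₁) (h₂ : x₂ ≠ y₂)
    (h : x₁ * x₂ ≠ y₁ * y₂) :
    y₁ * y₂ / (x₁ * x₂ - y₁ * y₂) * (1 + y₁ / (x₁ - y₁) + y₂ / (x₂ - y₂)) =
      y₁ / (x₁ - y₁) * (y₂ / (x₂ - y₂)) := by
  have h₁' := sub_ne_zero.mpr h₁
  have h₂' := sub_ne_zero.mpr h₂
  have h' := sub_ne_zero.mpr h
  field_simp
  ring

open Classical in
lemma isBaxterDatum_of_isMultiplicative (b : P.Base) (B : P.InvariantForm)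
    (E₁ E₂ : PosRoot b → k) (hE₁ : IsMultiplicative b E₁) (hE₂ : IsMultiplicative b E₂)
    (hE : ∀ α : PosRoot b, E₁ α ≠ E₂ α) (κ p q : reflections b → k)
    (hκ : ∀ (τ σ : reflections b) (α β : PosRoot b),
      (τ : P.weylGroup) = refl P α → (σ : P.weylGroup) = refl P β →
      B.form (P.root α) (P.root α) = B.form (P.root β) (P.root β) → κ τ = κ σ)
    (hp : ∀ (τ : reflections b) (α : PosRoot b),
      (τ : P.weylGroup) = refl P α → p τ = κ τ * E₁ α / (E₁ α - E₂ α))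
    (hq : ∀ (τ : reflections b) (α : PosRoot b),
      (τ : P.weylGroup) = refl P α → q τ = κ τ * E₂ α / (E₁ α - E₂ α)) :
    IsBaxterDatum b B p q κ
      -- The value 0 off the positive roots is arbitrary: every condition on F assumes positivity.
      (fun l => if h : b.IsPos l then E₂ ⟨l, h⟩ / (E₁ ⟨l, h⟩ - E₂ ⟨l, h⟩) else 0) where
  sub_eq τ l hl h := by
    have h0 := sub_ne_zero.mpr (hE ⟨l, hl⟩)
    rw [hp τ ⟨l, hl⟩ h, hq τ ⟨l, hl⟩ h]
    field_simp
  eq_mul τ l hl h := by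
    rw [hq τ ⟨l, hl⟩ h, dif_pos hl, mul_div_assoc]
  length_eq τ σ l l' hl hl' h h' hB := hκ τ σ ⟨l, hl⟩ ⟨l', hl'⟩ h h' hB
  add_eq l l₁ l₂ hl h₁ h₂ h := by
    have e₁ := hE₁ ⟨l₁, h₁⟩ ⟨l₂, h₂⟩ ⟨l, hl⟩ h
    have e₂ := hE₂ ⟨l₁, h₁⟩ ⟨l₂, h₂⟩ ⟨l, hl⟩ h
    have h0 := hE ⟨l, hl⟩
    rw [dif_pos hl, dif_pos h₁, dif_pos h₂, e₁, e₂]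
    rw [e₁, e₂] at h0
    exact functional_equation (hE _) (hE _) h0

end Multiplicative

end MixedBruhat

end

theorem theorem3p3 {ι V N k : Type*} [Finite ι] [AddCommGroup V] [Module ℝ V]
    [AddCommGroup N] [Module ℝ N] (P : RootPairing ι ℝ V N) [P.IsRootSystem]
    [P.IsCrystallographic] [P.IsReduced] (b : P.Base) (B : P.InvariantForm)
    [Field k] [CharZero k]
    (E₁ E₂ : MixedBruhat.PosRoot b → k)
    (hE₁ : MixedBruhat.IsMultiplicative b E₁) (hE₂ : MixedBruhat.IsMultiplicative b E₂)
    (hE : ∀ α : MixedBruhat.PosRoot b, E₁ α ≠ E₂ α)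
    (κ p q : MixedBruhat.reflections b → k)
    (hκ : ∀ (τ σ : MixedBruhat.reflections b) (α β : MixedBruhat.PosRoot b),
      (τ : P.weylGroup) = MixedBruhat.refl P α → (σ : P.weylGroup) = MixedBruhat.refl P β →
      B.form (P.root α) (P.root α) = B.form (P.root β) (P.root β) → κ τ = κ σ)
    (hp : ∀ (τ : MixedBruhat.reflections b) (α : MixedBruhat.PosRoot b),
      (τ : P.weylGroup) = MixedBruhat.refl P α → p τ = κ τ * E₁ α / (E₁ α - E₂ α))
    (hq : ∀ (τ : MixedBruhat.reflections b) (α : MixedBruhat.PosRoot b),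
      (τ : P.weylGroup) = MixedBruhat.refl P α → q τ = κ τ * E₂ α / (E₁ α - E₂ α)) :
    MixedBruhat.IsYangBaxterSolution b (fun τ =>
      (1 + Polynomial.X * Polynomial.C (MixedBruhat.mixedBruhat b p q τ) :
        Polynomial (Module.End k (P.weylGroup →₀ k)))) ∧
    ∀ ε : k, MixedBruhat.IsYangBaxterSolution b
      (fun τ => 1 + ε • MixedBruhat.mixedBruhat b p q τ) := by
  have h ε := (MixedBruhat.isBaxterDatum_of_isMultiplicative b B E₁ E₂ hE₁ hE₂ hE κ p q hκ hp hq
    ).isYangBaxterSolution ε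
  exact ⟨MixedBruhat.isYangBaxterSolution_polynomial b _ h, h⟩
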